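/- Let $k$ be a field, $R = k[x_1,\ldots,x_r]$ with $r > 2$, $\mathfrak m = (x_1,\ldots,x_r)$, and let $I \subseteq R$ be a monomial ideal, i.e. an ideal generated by monomials. For an ideal $\mathfrak a$ of $R$ let $\overline{\mathfrak a}$ denote its integral closure, i.e. the ideal of all $x \in R$ satisfying an equation $x^n + a_1x^{n-1} + \cdots + a_{n-1}x + a_n = 0$ with $n \geq 1$ and $a_i \in \mathfrak a^i$ for $i = 1,\ldots,n$. Let $G(I)$ be the minimal generating system of monomials of $I$, and let $$d(I) := \max\{\alpha_1+\cdots+\alpha_r \mid x_1^{\alpha_1}\cdots x_r^{\alpha_r} \in G(I)\}$$ be the maximal generating degree of $I$ (with $d(0) := 0$). If $\mathfrak m \in \operatorname{Ass} R/\overline{I^s}$ for some integer $s \geq 1$, then $$\mathfrak m \in \operatorname{Ass} R/\overline{I^n} \quad\text{for all integers } n \geq (r-1)\,r\,d(I)^{r-2}.$$ -/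

import Mathlib

/-- `x` is integral over the ideal `I`: it satisfies an equation
`x ^ n + a₁ x ^ (n - 1) + ⋯ + aₙ = 0` with `n ≥ 1` and `aᵢ ∈ I ^ i` for `i = 1, …, n`. -/
def IsIntegralOverIdeal {R : Type*} [CommRing R] (I : Ideal R) (x : R) : Prop :=
  ∃ n : ℕ, 1 ≤ n ∧ ∃ a : ℕ → R, (∀ i ∈ Finset.Icc 1 n, a i ∈ I ^ i) ∧
    x ^ n + ∑ i ∈ Finset.Icc 1 n, a i * x ^ (n - i) = 0

/-- `x` is integral over `I` iff `x t` is integral over the Rees algebra `R[I t]`.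
It is used only to show that the elements integral over `I` form an ideal. -/
theorem isIntegralOverIdeal_iff {R : Type*} [CommRing R] (I : Ideal R) (x : R) :
    IsIntegralOverIdeal I x ↔ IsIntegral (reesAlgebra I) (Polynomial.monomial 1 x) := by
  constructor
  · rintro ⟨n, hn, a, ha, h⟩
    classical
    let b : ℕ → reesAlgebra I := fun i =>
      if hi : i ∈ Finset.Icc 1 n then
        ⟨Polynomial.monomial i (a i), reesAlgebra.monomial_mem.mpr (ha i hi)⟩ else 0
    refine ⟨Polynomial.X ^ n +
      ∑ i ∈ Finset.Icc 1 n, Polynomial.C (b i) * Polynomial.X ^ (n - i), ?_, ?_⟩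
    · refine Polynomial.monic_X_pow_add (lt_of_le_of_lt (Polynomial.degree_sum_le _ _) ?_)
      refine (Finset.sup_lt_iff (WithBot.bot_lt_coe n)).mpr fun i hi => ?_
      refine lt_of_le_of_lt (Polynomial.degree_C_mul_X_pow_le _ _) ?_
      rw [Finset.mem_Icc] at hi
      exact WithBot.coe_lt_coe.mpr (show n - i < n by omega)
    · rw [Polynomial.eval₂_add, Polynomial.eval₂_X_pow, Polynomial.eval₂_finsetSum,
        Polynomial.monomial_pow]
      have key : ∀ i ∈ Finset.Icc 1 n,
          Polynomial.eval₂ (algebraMap (reesAlgebra I) (Polynomial R)) (Polynomial.monomial 1 x)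
            (Polynomial.C (b i) * Polynomial.X ^ (n - i)) =
          Polynomial.monomial n (a i * x ^ (n - i)) := by
        intro i hi
        have hb : (algebraMap (reesAlgebra I) (Polynomial R)) (b i) =
            Polynomial.monomial i (a i) := by
          simp only [b, dif_pos hi]
          rfl
        rw [Polynomial.eval₂_mul, Polynomial.eval₂_C, Polynomial.eval₂_X_pow, hb,
          Polynomial.monomial_pow, Polynomial.monomial_mul_monomial]
        rw [Finset.mem_Icc] at hi
        congr 2
        omega
      rw [Finset.sum_congr rfl key, ← map_sum, one_mul, ← map_add, h, map_zero]
  · rintro ⟨p, hp, h⟩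
    rcases subsingleton_or_nontrivial R with hR | hR
    · exact ⟨1, le_rfl, 0, fun i _ => Ideal.zero_mem _, Subsingleton.elim _ _⟩
    have hn : 1 ≤ p.natDegree := by
      by_contra hlt
      rw [(Polynomial.Monic.natDegree_eq_zero hp).mp (by omega)] at h
      simp at h
    refine ⟨p.natDegree, hn, fun i => ((p.coeff (p.natDegree - i) : reesAlgebra I) :
      Polynomial R).coeff i, fun i _ => (p.coeff (p.natDegree - i)).2 i, ?_⟩
    have hc := congrArg (fun f : Polynomial R => f.coeff p.natDegree) h
    simp only [Polynomial.eval₂_eq_sum_range, Polynomial.finsetSum_coeff,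
      Polynomial.coeff_zero, Polynomial.monomial_pow, one_mul] at hc
    rw [Finset.sum_range_succ, hp.coeff_natDegree] at hc
    simp only [map_one, one_mul, Polynomial.coeff_monomial, if_true] at hc
    rw [add_comm, ← hc]
    congr 1
    refine Finset.sum_bij' (fun i _ => p.natDegree - i) (fun j _ => p.natDegree - j)
      ?_ ?_ ?_ ?_ ?_
    · intro i hi; simp only [Finset.mem_Icc, Finset.mem_range] at *; omega
    · intro i hi; simp only [Finset.mem_Icc, Finset.mem_range] at *; omega
    · intro i hi; simp only [Finset.mem_Icc] at *; omega
    · intro i hi; simp only [Finset.mem_range] at *; omega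
    · intro i hi
      rw [Finset.mem_Icc] at hi
      have e : p.natDegree = i + (p.natDegree - i) := by omega
      conv_rhs => rw [show ∀ f : Polynomial R, f.coeff p.natDegree =
        f.coeff (i + (p.natDegree - i)) from fun f => by rw [← e]]
      rw [Polynomial.coeff_mul_monomial]
      rfl

/-- The integral closure of an ideal `I`: the ideal of all elements integral over `I`. -/
def Ideal.integralClosureIdeal {R : Type*} [CommRing R] (I : Ideal R) : Ideal R where
  carrier := {x | IsIntegralOverIdeal I x}
  add_mem' {x y} hx hy := by
    rw [Set.mem_ofPred_eq, isIntegralOverIdeal_iff] at *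
    rw [map_add]
    exact hx.add hy
  zero_mem' := by
    rw [Set.mem_ofPred_eq, isIntegralOverIdeal_iff, map_zero]
    exact isIntegral_zero
  smul_mem' c x hx := by
    rw [Set.mem_ofPred_eq, isIntegralOverIdeal_iff] at *
    have e : Polynomial.monomial 1 (c • x) =
        algebraMap (reesAlgebra I) (Polynomial R) (algebraMap R (reesAlgebra I) c) *
          Polynomial.monomial 1 x := by
      rw [← IsScalarTower.algebraMap_apply, ← Polynomial.C_eq_algebraMap, Polynomial.C_mul_monomial,
        smul_eq_mul]
    rw [e]
    exact isIntegral_algebraMap.mul hx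

namespace MvPolynomial

variable {σ k : Type*} [Field k]

/-- A monomial ideal: an ideal generated by a set of monomials `x ^ α`. -/
def IsMonomialIdeal (I : Ideal (MvPolynomial σ k)) : Prop :=
  ∃ S : Set (σ →₀ ℕ), I = Ideal.span ((fun α => monomial α (1 : k)) '' S)

/-- The exponent set `E(I)`: all `α` with `x ^ α ∈ I`. -/
def exponentSet (I : Ideal (MvPolynomial σ k)) : Set (σ →₀ ℕ) :=
  {α | monomial α (1 : k) ∈ I}

/-- The exponents of the monomials in `G(I)`, the minimal monomial generating system of `I`:
the monomials of `I` that are minimal under divisibility. -/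
def minimalGenerators (I : Ideal (MvPolynomial σ k)) : Set (σ →₀ ℕ) :=
  {α | Minimal (fun β => β ∈ exponentSet I) α}

theorem finite_minimalGenerators [Finite σ] (I : Ideal (MvPolynomial σ k)) :
    (minimalGenerators I).Finite :=
  WellQuasiOrderedLE.finite_of_isAntichain (setOfPred_minimal_antichain _)

/-- `G(I)` generates the monomial ideal `I`. -/
theorem IsMonomialIdeal.span_minimalGenerators [Finite σ] {I : Ideal (MvPolynomial σ k)}
    (hI : IsMonomialIdeal I) :
    Ideal.span ((fun α => monomial α (1 : k)) '' minimalGenerators I) = I := by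
  apply le_antisymm
  · rw [Ideal.span_le]
    rintro _ ⟨α, hα, rfl⟩
    exact hα.prop
  · obtain ⟨S, hS⟩ := hI
    conv_lhs => rw [hS]
    rw [Ideal.span_le]
    rintro _ ⟨α, hα, rfl⟩
    have hmem : α ∈ exponentSet I := by
      change monomial α (1 : k) ∈ I
      rw [hS]
      exact Ideal.subset_span ⟨α, hα, rfl⟩
    obtain ⟨β, hle, hβ⟩ := exists_minimal_le_of_wellFoundedLT (fun β => β ∈ exponentSet I) α hmem
    rw [SetLike.mem_coe, mem_ideal_span_monomial_image]
    intro γ hγ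
    rw [Finset.mem_singleton.mp (support_monomial_subset hγ)]
    exact ⟨β, hβ, hle⟩

/-- Every generating set of monomials of `I` contains `G(I)`. -/
theorem minimalGenerators_subset {I : Ideal (MvPolynomial σ k)} {S : Set (σ →₀ ℕ)}
    (hS : I = Ideal.span ((fun α => monomial α (1 : k)) '' S)) : minimalGenerators I ⊆ S := by
  intro α hα
  have hmem : monomial α (1 : k) ∈ I := hα.prop
  rw [hS, mem_ideal_span_monomial_image] at hmem
  classical
  obtain ⟨β, hβ, hle⟩ := hmem α (by rw [mem_support_iff, coeff_monomial, if_pos rfl]; exact one_ne_zero)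
  have hβ' : β ∈ exponentSet I := by
    change monomial β (1 : k) ∈ I
    rw [hS]
    exact Ideal.subset_span ⟨β, hβ, rfl⟩
  rwa [le_antisymm (hα.le_of_le hβ' hle) hle]

/-- The maximal generating degree `d(I) = max {α₁ + ⋯ + αᵣ | x ^ α ∈ G(I)}`
(with `d(0) = 0`). -/
noncomputable def maxGenDegree [Finite σ] (I : Ideal (MvPolynomial σ k)) : ℕ :=
  (finite_minimalGenerators I).toFinset.sup Finsupp.degree

end MvPolynomial

/-! Let P be the Newton polyhedron of G = G(I). The integral closure of I^n is spanned by the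
monomials with exponent in nP (`mem_integralClosureIdeal_iff`), so m is associated to it exactly
when some lattice point lies just below nP: outside nP, but inside after adding any unit vector.

Such a point for n = s forces P to have a compact facet, on which a weight w with all w_i > 0 takes
the value 1 and whose generators span the whole space (`exists_positive_weight_span_eq_top`).

Conversely, choose r linearly independent generators v_j on that facet and write e_i = ∑_j M_ij v_j.
Let w_{i₀} be minimal and β = ∑_j m_j v_j - e_{i₀} with ∑ m_j = n. Then β has weight n - w_{i₀} < n,
while β + e_i = ∑_j (m_j + M_ij - M_{i₀j}) v_j has coefficient sum n + w_i - w_{i₀} ≥ n. It remains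
to have nonnegative coefficients, for which m_j ≥ 2 max |M_ij| suffices. The determinant estimate
|M_ij| ≤ d^(r-2) therefore gives the bound n ≥ 2 r d^(r-2), which is at most (r-1) r d^(r-2). -/

/-! ### Linear inequalities over an ordered field. -/

/-- **Farkas' lemma** over a linearly ordered field: a linear functional that is nonnegative
wherever finitely many given functionals are nonnegative is a conical combination of them. -/
theorem exists_nonneg_combination_of_forall_nonneg {K V ι : Type*} [Field K] [LinearOrder K]
    [IsStrictOrderedRing K] [AddCommGroup V] [Module K V] (s : Finset ι)
    (A : ι → V →ₗ[K] K) (b : V →ₗ[K] K)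
    (h : ∀ x, (∀ i ∈ s, 0 ≤ A i x) → 0 ≤ b x) :
    ∃ c : ι → K, (∀ i, 0 ≤ c i) ∧ b = ∑ i ∈ s, c i • A i := by
  classical
  induction s using Finset.induction_on generalizing A b with
  | empty =>
    refine ⟨0, fun _ => le_rfl, LinearMap.ext fun x => ?_⟩
    have h1 := h x (by simp)
    have h2 := h (-x) (by simp)
    rw [map_neg] at h2
    simp only [Finset.sum_empty, LinearMap.zero_apply]
    linarith
  | insert j s hj ih =>
    by_cases hs : ∀ x, (∀ i ∈ s, 0 ≤ A i x) → 0 ≤ b x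
    · obtain ⟨c, hc, hb⟩ := ih A b hs
      refine ⟨Function.update c j 0, fun i => ?_, ?_⟩
      · by_cases hij : i = j
        · subst hij; simp
        · simpa [hij] using hc i
      · rw [Finset.sum_insert hj, hb, Function.update_self, zero_smul, zero_add]
        refine Finset.sum_congr rfl fun i hi => ?_
        rw [Function.update_of_ne (ne_of_mem_of_not_mem hi hj)]
    · push Not at hs
      obtain ⟨y, hy, hby⟩ := hs
      have hjy : A j y < 0 := by
        by_contra hcon
        push Not at hcon
        refine hby.not_ge (h y fun i hi => ?_)
        rcases Finset.mem_insert.mp hi with rfl | hi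
        · exact hcon
        · exact hy i hi
      set t : K := (-(A j y))⁻¹ with ht
      have ht0 : 0 < t := inv_pos.mpr (by linarith)
      have htj : t * A j y = -1 := by
        rw [ht, inv_neg, neg_mul, inv_mul_cancel₀ hjy.ne]
      -- These functionals are the old ones composed with x ↦ x + t A_j(x) y, the projection onto
      -- ker A_j along y; it is a projection because t A_j(y) = -1.
      obtain ⟨c, hc, hb⟩ := ih (fun i => A i + (t * A i y) • A j) (b + (t * b y) • A j) (by
        intro x hx
        have := h (x + (t * A j x) • y) (by
          intro i hi
          rcases Finset.mem_insert.mp hi with rfl | hi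
          · have : A i x + t * A i x * A i y = 0 := by linear_combination A i x * htj
            simp [this]
          · have := hx i hi
            simp only [LinearMap.add_apply, LinearMap.smul_apply, smul_eq_mul, map_add,
              map_smul] at this ⊢
            linarith)
        simp only [LinearMap.add_apply, LinearMap.smul_apply, smul_eq_mul, map_add,
          map_smul] at this ⊢
        linarith)
      refine ⟨Function.update c j (∑ i ∈ s, c i * (t * A i y) - t * b y), fun i => ?_, ?_⟩
      · by_cases hij : i = j
        · subst hij
          rw [Function.update_self]
          have h1 : 0 ≤ ∑ l ∈ s, c l * (t * A l y) :=
            Finset.sum_nonneg fun l hl => mul_nonneg (hc l) (mul_nonneg ht0.le (hy l hl))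
          have h2 := mul_neg_of_pos_of_neg ht0 hby
          linarith
        · simpa [hij] using hc i
      · rw [Finset.sum_insert hj, Function.update_self]
        have : ∑ i ∈ s, Function.update c j (∑ i ∈ s, c i * (t * A i y) - t * b y) i • A i =
            ∑ i ∈ s, c i • A i := by
          refine Finset.sum_congr rfl fun i hi => ?_
          rw [Function.update_of_ne (ne_of_mem_of_not_mem hi hj)]
        rw [this]
        refine LinearMap.ext fun x => ?_
        have hx := LinearMap.congr_fun hb x
        simp only [LinearMap.add_apply, LinearMap.smul_apply, smul_eq_mul, LinearMap.sum_apply,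
          mul_add, Finset.sum_add_distrib] at hx ⊢
        rw [sub_mul, Finset.sum_mul]
        simp only [mul_assoc] at hx ⊢
        linarith

/-- Moving along a ray, the first of finitely many affine constraints becomes tight. -/
theorem exists_first_tight {K ι : Type*} [Field K] [LinearOrder K] [IsStrictOrderedRing K]
    [Finite ι] (p q : ι → K) (hp : ∀ j, 0 ≤ p j) (hq : ∃ j, q j < 0) :
    ∃ t : K, 0 ≤ t ∧ (∀ j, 0 ≤ p j + t * q j) ∧ ∃ j, q j < 0 ∧ p j + t * q j = 0 := by
  classical
  have := Fintype.ofFinite ι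
  obtain ⟨j, hj, hmin⟩ := Finset.exists_min_image (Finset.univ.filter fun j => q j < 0)
    (fun j => p j / (-q j)) (by obtain ⟨j, hj⟩ := hq; exact ⟨j, by simpa using hj⟩)
  have hj' : q j < 0 := by simpa using hj
  have ht : 0 ≤ p j / (-q j) := div_nonneg (hp j) (by linarith)
  refine ⟨p j / (-q j), ht, fun l => ?_, j, hj', ?_⟩
  · by_cases hl : q l < 0
    · have h1 := hmin l (by simpa using hl)
      have h2 : p l / (-q l) * (-q l) = p l := div_mul_cancel₀ _ (by linarith)
      have h3 := mul_le_mul_of_nonneg_right h1 (show 0 ≤ -q l by linarith)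
      rw [h2] at h3
      linarith
    · push Not at hl
      have := mul_nonneg ht hl
      linarith [hp l]
  · have h2 : p j / (-q j) * (-q j) = p j := div_mul_cancel₀ _ (by linarith)
    linarith

/-! ### Newton polyhedra, separating weights and compact facets. -/

section NewtonPolyhedron

variable {σ : Type*}

/-- The value of the linear form with coefficients `w` at the exponent `α`. -/
def weightAt [Fintype σ] (w : σ → ℚ) (α : σ →₀ ℕ) : ℚ := ∑ i, w i * α i

/-- The rational point with the coordinates of the exponent `α`. -/
def ratVec (α : σ →₀ ℕ) : σ → ℚ := fun i => α i

/-- The exponent `α` lies in `n` times the Newton polyhedron spanned by `G`. -/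
def InDilatedNewton (G : Finset (σ →₀ ℕ)) (n : ℕ) (α : σ →₀ ℕ) : Prop :=
  ∃ c : (σ →₀ ℕ) → ℚ, (∀ g, 0 ≤ c g) ∧ (n : ℚ) ≤ ∑ g ∈ G, c g ∧
    ∀ i, ∑ g ∈ G, c g * g i ≤ α i

theorem weightAt_add [Fintype σ] (w : σ → ℚ) (α β : σ →₀ ℕ) :
    weightAt w (α + β) = weightAt w α + weightAt w β := by
  simp [weightAt, mul_add, Finset.sum_add_distrib]

theorem weightAt_single [Fintype σ] (w : σ → ℚ) (i : σ) : weightAt w (Finsupp.single i 1) = w i := by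
  classical
  simp [weightAt, Finsupp.single_apply]

theorem weightAt_add_smul [Fintype σ] (w u : σ → ℚ) (t : ℚ) (α : σ →₀ ℕ) :
    weightAt (w + t • u) α = weightAt w α + t * weightAt u α := by
  simp only [weightAt, Pi.add_apply, Pi.smul_apply, smul_eq_mul, add_mul,
    Finset.sum_add_distrib, Finset.mul_sum, mul_assoc]

theorem weightAt_neg [Fintype σ] (w : σ → ℚ) (α : σ →₀ ℕ) : weightAt (-w) α = -weightAt w α := by
  simp [weightAt]

theorem weightAt_nonneg [Fintype σ] {w : σ → ℚ} (hw : ∀ i, 0 ≤ w i) (α : σ →₀ ℕ) : 0 ≤ weightAt w α :=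
  Finset.sum_nonneg fun i _ => mul_nonneg (hw i) (Nat.cast_nonneg _)

theorem InDilatedNewton.le_weightAt [Fintype σ] {G : Finset (σ →₀ ℕ)} {n : ℕ} {α : σ →₀ ℕ}
    (h : InDilatedNewton G n α) {w : σ → ℚ} (hw : ∀ i, 0 ≤ w i)
    (hG : ∀ g ∈ G, 1 ≤ weightAt w g) : (n : ℚ) ≤ weightAt w α := by
  obtain ⟨c, hc, hn, hα⟩ := h
  calc (n : ℚ) ≤ ∑ g ∈ G, c g := hn
    _ ≤ ∑ g ∈ G, c g * weightAt w g :=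
        Finset.sum_le_sum fun g hg => le_mul_of_one_le_right (hc g) (hG g hg)
    _ = ∑ i, w i * ∑ g ∈ G, c g * g i := by
        simp only [weightAt, Finset.mul_sum]
        rw [Finset.sum_comm]
        exact Finset.sum_congr rfl fun i _ => Finset.sum_congr rfl fun g _ => by ring
    _ ≤ weightAt w α :=
        Finset.sum_le_sum fun i _ => mul_le_mul_of_nonneg_left (hα i) (hw i)

/-- The family may repeat generators; coefficients are summed over the fibres of `v`. -/
theorem InDilatedNewton.of_family {ι : Type*} [Fintype ι] {G : Finset (σ →₀ ℕ)} {n : ℕ}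
    {α : σ →₀ ℕ} (v : ι → σ →₀ ℕ) (hv : ∀ j, v j ∈ G) (c : ι → ℚ) (hc : ∀ j, 0 ≤ c j)
    (hn : (n : ℚ) ≤ ∑ j, c j) (hα : ∀ i, ∑ j, c j * v j i ≤ α i) :
    InDilatedNewton G n α := by
  classical
  refine ⟨fun g => ∑ j with v j = g, c j, fun g => Finset.sum_nonneg fun j _ => hc j, ?_,
    fun i => ?_⟩
  · rwa [Finset.sum_fiberwise_of_maps_to (fun j _ => hv j)]
  · refine le_trans (le_of_eq ?_) (hα i)
    rw [← Finset.sum_fiberwise_of_maps_to (fun j _ => hv j) (fun j => c j * (v j i : ℚ))]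
    refine Finset.sum_congr rfl fun g _ => ?_
    rw [Finset.sum_mul]
    refine Finset.sum_congr rfl fun j hj => ?_
    rw [(Finset.mem_filter.mp hj).2]

/-- A point outside the dilated Newton polyhedron is separated from it by a rational weight. -/
theorem exists_weight_of_not_inDilatedNewton [Fintype σ] {G : Finset (σ →₀ ℕ)} {n : ℕ} {α : σ →₀ ℕ}
    (h : ¬ InDilatedNewton G n α) :
    ∃ w : σ → ℚ, (∀ i, 0 ≤ w i) ∧ (∀ g ∈ G, 1 ≤ weightAt w g) ∧ weightAt w α < n := by
  classical
  by_contra hcon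
  push Not at hcon
  -- Homogenization: a variable y replaces the constant 1, so that Farkas' lemma applies to the cone
  -- w·g ≥ y, w ≥ 0, y ≥ 0 and the functional w·α - n y.
  let L : (σ →₀ ℕ) → ((σ → ℚ) × ℚ) →ₗ[ℚ] ℚ := fun g =>
    ∑ i, (g i : ℚ) • (LinearMap.proj i ∘ₗ LinearMap.fst ℚ (σ → ℚ) ℚ)
  have hL : ∀ g x, L g x = weightAt x.1 g := by
    intro g x
    simp [L, weightAt, mul_comm]
  let Y : ((σ → ℚ) × ℚ) →ₗ[ℚ] ℚ := LinearMap.snd ℚ (σ → ℚ) ℚ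
  let A : G ⊕ σ ⊕ Unit → ((σ → ℚ) × ℚ) →ₗ[ℚ] ℚ :=
    Sum.elim (fun g => L g - Y) (Sum.elim
      (fun i => LinearMap.proj i ∘ₗ LinearMap.fst ℚ (σ → ℚ) ℚ) (fun _ => Y))
  obtain ⟨c, hc, hb⟩ := exists_nonneg_combination_of_forall_nonneg Finset.univ A
    (L α - (n : ℚ) • Y) (by
      intro x hx
      have hg : ∀ g ∈ G, x.2 ≤ weightAt x.1 g := fun g hg => by
        have := hx (Sum.inl ⟨g, hg⟩) (Finset.mem_univ _)
        simpa [A, hL, Y] using this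
      have hi : ∀ i, 0 ≤ x.1 i := fun i => by
        have := hx (Sum.inr (Sum.inl i)) (Finset.mem_univ _)
        simpa [A] using this
      have hy : 0 ≤ x.2 := by
        have := hx (Sum.inr (Sum.inr ())) (Finset.mem_univ _)
        simpa [A, Y] using this
      simp only [LinearMap.sub_apply, hL, LinearMap.smul_apply, smul_eq_mul, Y,
        LinearMap.snd_apply]
      -- For y = 0 only w ≥ 0 is needed; for y > 0 rescaling by 1/y returns to the inhomogeneous
      -- inequalities.
      rcases hy.eq_or_lt with hy | hy
      · rw [← hy, mul_zero, sub_zero]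
        exact weightAt_nonneg hi α
      · have hs : ∀ β, weightAt (x.2⁻¹ • x.1) β = x.2⁻¹ * weightAt x.1 β := fun β => by
          simp [weightAt, Finset.mul_sum, mul_assoc]
        have := hcon (x.2⁻¹ • x.1)
          (fun i => mul_nonneg (inv_nonneg.mpr hy.le) (hi i))
          (fun g hgG => by
            rw [hs, inv_mul_eq_div, le_div_iff₀ hy, one_mul]
            exact hg g hgG)
        rw [hs, inv_mul_eq_div, le_div_iff₀ hy] at this
        linarith)
  apply h
  refine InDilatedNewton.of_family (fun g : G => (g : σ →₀ ℕ)) (fun g => g.2)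
    (fun g => c (Sum.inl g)) (fun g => hc _) ?_ fun i => ?_
  -- Evaluation at (0, 1) compares the coefficients of y, and below at (e_i, 0) those of w_i; the
  -- multipliers of y ≥ 0 and w_i ≥ 0 are the slacks.
  · have := LinearMap.congr_fun hb (0, 1)
    simp [A, hL, Y, weightAt, Fintype.sum_sum_type] at this
    have h0 := hc (Sum.inr (Sum.inr ()))
    simp only [Finset.univ_eq_attach]
    linarith
  · have := LinearMap.congr_fun hb (Pi.single i 1, 0)
    simp [A, hL, Y, weightAt, Fintype.sum_sum_type, Pi.single_apply] at this
    have h0 := hc (Sum.inr (Sum.inl i))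
    simp only [Finset.univ_eq_attach]
    linarith

/-- At a point just outside the dilated Newton polyhedron, the polyhedron has a compact facet:
a positive weight whose minimal generators span the whole space. -/
theorem exists_positive_weight_span_eq_top [Fintype σ] {G : Finset (σ →₀ ℕ)} {n : ℕ} {α : σ →₀ ℕ}
    (h : ¬ InDilatedNewton G n α)
    (h' : ∀ i, InDilatedNewton G n (α + Finsupp.single i 1)) :
    ∃ w : σ → ℚ, (∀ i, 0 < w i) ∧ (∀ g ∈ G, 1 ≤ weightAt w g) ∧
      Submodule.span ℚ (ratVec '' {g | g ∈ G ∧ weightAt w g = 1}) = ⊤ := by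
  classical
  let W : (σ → ℚ) → Prop := fun w =>
    (∀ i, 0 ≤ w i) ∧ (∀ g ∈ G, 1 ≤ weightAt w g) ∧ weightAt w α < n
  -- Weight less than n at α but at least n at α + e_i leaves w_i > 0.
  have hpos : ∀ w, W w → ∀ i, 0 < w i := by
    rintro w ⟨hw, hG, hα⟩ i
    have := (h' i).le_weightAt hw hG
    rw [weightAt_add, weightAt_single] at this
    linarith
  let tight : (σ → ℚ) → Finset (σ →₀ ℕ) := fun w => G.filter fun g => weightAt w g = 1
  obtain ⟨w₀, hw₀⟩ := exists_weight_of_not_inDilatedNewton h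
  -- There may be infinitely many separating weights, but only finitely many sets of tight
  -- generators; a weight with the most tight generators is taken.
  obtain ⟨T, hT, hmax⟩ := Finset.exists_max_image
    (G.powerset.filter fun T => ∃ w, W w ∧ tight w = T) Finset.card
    ⟨tight w₀, by simpa using ⟨Finset.filter_subset _ _, w₀, hw₀, rfl⟩⟩
  obtain ⟨-, w, hw, rfl⟩ := Finset.mem_filter.mp hT
  refine ⟨w, hpos w hw, hw.2.1, ?_⟩
  -- Moving from w along u keeps α separated and the tight generators tight. The first constraint
  -- reached is either a new generator, against maximality, or w_i = 0, against positivity.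
  have step : ∀ u : σ → ℚ, (∀ g ∈ tight w, weightAt u g = 0) → weightAt u α ≤ 0 →
      (∃ i, u i < 0) → False := by
    rintro u hu huα ⟨i₀, hi₀⟩
    obtain ⟨t, ht, hall, j, hj, hj0⟩ := exists_first_tight (ι := G ⊕ σ)
      (Sum.elim (fun g => weightAt w g - 1) w) (Sum.elim (fun g => weightAt u g) u)
      (by
        rintro (g | i)
        · have := hw.2.1 g g.2
          simp only [Sum.elim_inl]; linarith
        · exact hw.1 i) ⟨Sum.inr i₀, hi₀⟩
    have hW : W (w + t • u) := by
      refine ⟨fun i => hall (Sum.inr i), fun g hg => ?_, ?_⟩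
      · have := hall (Sum.inl ⟨g, hg⟩)
        simp only [Sum.elim_inl] at this
        rw [weightAt_add_smul]; linarith
      · rw [weightAt_add_smul]
        have := mul_nonpos_of_nonneg_of_nonpos ht huα
        linarith [hw.2.2]
    rcases j with g | i
    · simp only [Sum.elim_inl] at hj hj0
      have hlt : tight w ⊂ tight (w + t • u) := by
        rw [Finset.ssubset_iff_of_subset]
        · refine ⟨g, Finset.mem_filter.mpr ⟨g.2, ?_⟩, fun hg => ?_⟩
          · rw [weightAt_add_smul]; linarith
          · rw [hu g hg] at hj
            exact lt_irrefl _ hj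
        · intro g' hg'
          refine Finset.mem_filter.mpr ⟨(Finset.mem_filter.mp hg').1, ?_⟩
          rw [weightAt_add_smul, hu g' hg', mul_zero, add_zero]
          exact (Finset.mem_filter.mp hg').2
      exact (Finset.card_lt_card hlt).not_ge (hmax _ (Finset.mem_filter.mpr
        ⟨Finset.mem_powerset.mpr (Finset.filter_subset _ _), _, hW, rfl⟩))
    · have := hpos _ hW i
      simp only [Sum.elim_inr] at hj0
      simp only [Pi.add_apply, Pi.smul_apply, smul_eq_mul] at this
      linarith
  by_contra hspan
  obtain ⟨f, hf, hker⟩ := Submodule.exists_le_ker_of_lt_top _ (lt_top_iff_ne_top.mpr hspan)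
  set u : σ → ℚ := fun i => f (Pi.single i 1) with hu_def
  have hfu : ∀ x, f x = ∑ i, x i * u i := fun x => by
    conv_lhs => rw [pi_eq_sum_univ' x]
    simp [hu_def, map_sum]
  have hu : ∀ g ∈ tight w, weightAt u g = 0 := by
    intro g hg
    have : f (ratVec g) = 0 := hker (Submodule.subset_span ⟨g, Finset.mem_filter.mp hg, rfl⟩)
    rw [hfu] at this
    rw [← this]
    exact Finset.sum_congr rfl fun i _ => mul_comm _ _
  obtain ⟨i, hi⟩ : ∃ i, u i ≠ 0 := by
    by_contra hall
    push Not at hall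
    exact hf (LinearMap.ext fun x => by simp [hfu, hall])
  have hun : ∀ g ∈ tight w, weightAt (-u) g = 0 := fun g hg => by
    rw [weightAt_neg, hu g hg, neg_zero]
  -- A nonzero functional killing the tight generators yields an admissible direction u or -u: one
  -- of them has a negative coordinate and is nonpositive at α.
  by_cases hneg : ∃ i, u i < 0
  · by_cases hnegα : weightAt u α ≤ 0
    · exact step u hu hnegα hneg
    · by_cases hpos' : ∃ i, 0 < u i
      · obtain ⟨i, hi⟩ := hpos'
        refine step (-u) hun ?_ ⟨i, by simpa using hi⟩
        rw [weightAt_neg]; linarith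
      · push Not at hpos'
        have := weightAt_nonneg (w := -u) (fun i => by simpa using hpos' i) α
        rw [weightAt_neg] at this
        linarith
  · push Not at hneg
    have hnn := weightAt_nonneg hneg α
    refine step (-u) hun ?_ ⟨i, ?_⟩
    · rw [weightAt_neg]; linarith
    · simpa using lt_of_le_of_ne (hneg i) (Ne.symm hi)

end NewtonPolyhedron

/-! ### Integral closures of powers of monomial ideals. -/

/-- An element integral over a power of a prime element is divisible by that power. -/
theorem pow_dvd_of_isIntegral {A : Type*} [CommRing A] [IsDomain A] [WfDvdMonoid A] {p : A}
    (hp : Prime p) {N n : ℕ} {F : A} {a : ℕ → A}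
    (ha : ∀ i ∈ Finset.Icc 1 n, p ^ (i * N) ∣ a i)
    (h : F ^ n + ∑ i ∈ Finset.Icc 1 n, a i * F ^ (n - i) = 0) : p ^ N ∣ F := by
  rcases eq_or_ne F 0 with rfl | hF
  · exact dvd_zero _
  by_contra hN
  obtain ⟨t, F', hF', rfl⟩ := WfDvdMonoid.max_power_factor hF hp.irreducible
  have htN : t < N := by
    by_contra hcon
    exact hN ((pow_dvd_pow p (not_lt.mp hcon)).trans (dvd_mul_right _ _))
  -- If F has order t < N, every other term has order at least iN + t(n - i) ≥ tn + 1, since i ≥ 1;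
  -- so F^n would have order above tn.
  have hdvd : p ^ (t * n + 1) ∣ (p ^ t * F') ^ n := by
    rw [eq_neg_of_add_eq_zero_left h, dvd_neg]
    refine Finset.dvd_sum fun i hi => ?_
    have hi' := Finset.mem_Icc.mp hi
    refine (pow_dvd_pow p (?_ : t * n + 1 ≤ i * N + t * (n - i))).trans ?_
    · obtain ⟨m, rfl⟩ := Nat.exists_eq_add_of_le hi'.2
      rw [Nat.add_sub_cancel_left]
      nlinarith [Nat.mul_le_mul_left i htN]
    · rw [pow_add, mul_pow, ← pow_mul]
      exact mul_dvd_mul (ha i hi) (dvd_mul_right _ _)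
  rw [mul_pow, ← pow_mul, pow_succ] at hdvd
  exact hF' (hp.dvd_of_dvd_pow
    ((mul_dvd_mul_iff_left (pow_ne_zero _ hp.ne_zero)).mp hdvd))

namespace MvPolynomial

variable {σ k : Type*} [Field k] [Fintype σ]

/-- The substitution `x_i ↦ x_i T ^ w_i`. -/
noncomputable def weightSubst (w : σ → ℕ) :
    MvPolynomial σ k →ₐ[k] Polynomial (MvPolynomial σ k) :=
  aeval fun i => Polynomial.C (X i) * Polynomial.X ^ w i

theorem weightSubst_monomial (w : σ → ℕ) (α : σ →₀ ℕ) (a : k) :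
    weightSubst w (monomial α a) = Polynomial.monomial (∑ i, w i * α i) (monomial α a) := by
  rw [weightSubst, aeval_monomial, Finsupp.prod_fintype _ _ (by simp)]
  simp only [mul_pow, Finset.prod_mul_distrib, ← pow_mul, Finset.prod_pow_eq_pow_sum]
  rw [← Polynomial.C_mul_X_pow_eq_monomial, monomial_eq, Finsupp.prod_fintype _ _ (by simp)]
  simp only [map_mul, map_prod, map_pow, mul_assoc]
  rfl

/-- The variables survive the substitution, so distinct monomials of equal weight cannot cancel: the
T-adic order is the least weight of a monomial of `f`. -/
theorem X_pow_dvd_weightSubst {w : σ → ℕ} {N : ℕ} {f : MvPolynomial σ k}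
    (h : Polynomial.X ^ N ∣ weightSubst w f) {α : σ →₀ ℕ} (hα : α ∈ f.support) :
    N ≤ ∑ i, w i * α i := by
  classical
  by_contra hcon
  have h0 := Polynomial.X_pow_dvd_iff.mp h _ (not_le.mp hcon)
  have h1 := congrArg (coeff α) h0
  conv at h1 => lhs; rw [f.as_sum, map_sum, Polynomial.finsetSum_coeff, coeff_sum]
  simp only [weightSubst_monomial, Polynomial.coeff_monomial, coeff_zero] at h1
  rw [Finset.sum_eq_single α] at h1
  · simp at h1
    exact (mem_support_iff.mp hα) h1
  · intro β _ hβ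
    split_ifs
    · rw [coeff_monomial, if_neg hβ]
    · simp
  · exact fun h => absurd hα h

/-- The elements integral over `I ^ n` satisfy the weight inequalities of the monomials of `I`. -/
theorem le_weight_of_mem_integralClosureIdeal {S : Set (σ →₀ ℕ)} {n : ℕ}
    {w : σ → ℕ} {c : ℕ} (hS : ∀ g ∈ S, c ≤ ∑ i, w i * g i) {f : MvPolynomial σ k}
    (hf : f ∈ (Ideal.span ((fun α => monomial α (1 : k)) '' S) ^ n).integralClosureIdeal)
    {α : σ →₀ ℕ} (hα : α ∈ f.support) : c * n ≤ ∑ i, w i * α i := by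
  have hmap : Ideal.map (weightSubst (k := k) w)
      (Ideal.span ((fun α => monomial α (1 : k)) '' S)) ≤
      Ideal.span {Polynomial.X ^ c} := by
    rw [Ideal.map_span, Ideal.span_le]
    rintro _ ⟨_, ⟨g, hg, rfl⟩, rfl⟩
    rw [SetLike.mem_coe, Ideal.mem_span_singleton, weightSubst_monomial,
      ← Polynomial.C_mul_X_pow_eq_monomial]
    exact (pow_dvd_pow _ (hS g hg)).trans (dvd_mul_left _ _)
  obtain ⟨m, -, a, ha, h⟩ := hf
  refine X_pow_dvd_weightSubst (w := w) (pow_dvd_of_isIntegral (n := m)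
    (a := fun i => weightSubst w (a i)) Polynomial.prime_X (fun i hi => ?_) ?_) hα
  · have h1 := Ideal.mem_map_of_mem (weightSubst (k := k) w) (ha i hi)
    rw [← pow_mul, Ideal.map_pow] at h1
    have h2 := Ideal.pow_right_mono hmap (n * i) h1
    rw [Ideal.span_singleton_pow, Ideal.mem_span_singleton, ← pow_mul] at h2
    convert h2 using 2
    ring
  · have := congrArg (weightSubst w) h
    simpa only [map_add, map_sum, map_mul, map_pow, map_zero] using this

omit [Fintype σ] in
theorem monomial_mem_pow_of_sum_le (G : Finset (σ →₀ ℕ)) (c : (σ →₀ ℕ) → ℕ) {γ : σ →₀ ℕ}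
    (h : ∑ g ∈ G, c g • g ≤ γ) :
    monomial γ (1 : k) ∈
      Ideal.span ((fun α => monomial α (1 : k)) '' (G : Set (σ →₀ ℕ))) ^ ∑ g ∈ G, c g := by
  obtain ⟨δ, rfl⟩ := exists_add_of_le h
  have hsplit : monomial (∑ g ∈ G, c g • g + δ) (1 : k) =
      monomial (∑ g ∈ G, c g • g) 1 * monomial δ 1 := by
    rw [monomial_mul, one_mul]
  rw [hsplit]
  refine Ideal.mul_mem_right _ _ ?_
  rw [monomial_sum_one, ← Finset.prod_pow_eq_pow_sum]
  refine Ideal.prod_mem_prod fun g hg => ?_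
  have : monomial (c g • g) (1 : k) = monomial g 1 ^ c g := by
    rw [monomial_pow, one_pow]
  rw [this]
  have hmem : monomial g (1 : k) ∈
      Ideal.span ((fun α => monomial α (1 : k)) '' (G : Set (σ →₀ ℕ))) :=
    Ideal.subset_span ⟨g, hg, rfl⟩
  exact Ideal.pow_mem_pow hmem _

omit [Fintype σ] in
theorem exists_nat_multiples {ι : Type*} (s : Finset ι) (c : ι → ℚ) (hc : ∀ i, 0 ≤ c i) :
    ∃ q : ℕ, 0 < q ∧ ∃ a : ι → ℕ, ∀ i ∈ s, (a i : ℚ) = q * c i := by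
  classical
  refine ⟨∏ i ∈ s, (c i).den, Finset.prod_pos fun i _ => (c i).den_pos,
    fun i => (∏ j ∈ s.erase i, (c j).den) * (c i).num.toNat, fun i hi => ?_⟩
  have h1 : ((c i).num.toNat : ℚ) = (c i).num := by
    exact_mod_cast Int.toNat_of_nonneg (Rat.num_nonneg.mpr (hc i))
  rw [← Finset.prod_erase_mul s _ hi]
  push_cast
  rw [h1, mul_assoc, Rat.den_mul_eq_num]

-- Clearing the denominators of the coefficients by q gives x^(qα) ∈ I^(nq), so x^α is a root of z^q
-- - x^(qα).
omit [Fintype σ] in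
theorem monomial_mem_integralClosureIdeal {G : Finset (σ →₀ ℕ)} {n : ℕ} {α : σ →₀ ℕ}
    (h : InDilatedNewton G n α) :
    monomial α (1 : k) ∈ (Ideal.span
      ((fun α => monomial α (1 : k)) '' (G : Set (σ →₀ ℕ))) ^ n).integralClosureIdeal := by
  obtain ⟨c, hc, hn, hα⟩ := h
  obtain ⟨q, hq, a, ha⟩ := exists_nat_multiples G c hc
  have hq' : (0 : ℚ) ≤ q := Nat.cast_nonneg q
  have hsum : n * q ≤ ∑ g ∈ G, a g := by
    have h1 : ((∑ g ∈ G, a g : ℕ) : ℚ) = q * ∑ g ∈ G, c g := by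
      rw [Nat.cast_sum, Finset.mul_sum]
      exact Finset.sum_congr rfl ha
    have h2 := mul_le_mul_of_nonneg_left hn hq'
    rw [← h1] at h2
    have h3 : q * n ≤ ∑ g ∈ G, a g := by exact_mod_cast h2
    linarith
  have hle : ∑ g ∈ G, a g • g ≤ q • α := by
    intro i
    have h2 := mul_le_mul_of_nonneg_left (hα i) hq'
    rw [Finset.mul_sum] at h2
    have h3 : ((∑ g ∈ G, a g * g i : ℕ) : ℚ) ≤ (q * α i : ℕ) := by
      push_cast
      refine le_trans (le_of_eq ?_) h2
      exact Finset.sum_congr rfl fun g hg => by rw [ha g hg, mul_assoc]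
    simpa [Finsupp.finsetSum_apply] using (by exact_mod_cast h3 :
      ∑ g ∈ G, a g * g i ≤ q * α i)
  have hmem := Ideal.pow_le_pow_right hsum (monomial_mem_pow_of_sum_le (k := k) G a hle)
  rw [pow_mul] at hmem
  refine ⟨q, hq, fun i => if i = q then -monomial (q • α) 1 else 0, fun i _ => ?_, ?_⟩
  · dsimp only
    split_ifs with hi
    · rw [hi]; exact neg_mem hmem
    · exact zero_mem _
  · rw [Finset.sum_eq_single_of_mem q (Finset.mem_Icc.mpr ⟨hq, le_rfl⟩)
      (fun i _ hi => by simp [hi])]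
    simp [monomial_pow]

theorem le_weightAt_of_mem_integralClosureIdeal {G : Finset (σ →₀ ℕ)} {n : ℕ}
    {w : σ → ℚ} (hw : ∀ i, 0 ≤ w i) (hG : ∀ g ∈ G, 1 ≤ weightAt w g) {f : MvPolynomial σ k}
    (hf : f ∈ (Ideal.span
      ((fun α => monomial α (1 : k)) '' (G : Set (σ →₀ ℕ))) ^ n).integralClosureIdeal)
    {α : σ →₀ ℕ} (hα : α ∈ f.support) : (n : ℚ) ≤ weightAt w α := by
  obtain ⟨q, hq, a, ha⟩ := exists_nat_multiples Finset.univ w hw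
  have hq' : (0 : ℚ) < q := Nat.cast_pos.mpr hq
  have key : ∀ β : σ →₀ ℕ, ((∑ i, a i * β i : ℕ) : ℚ) = q * weightAt w β := fun β => by
    rw [weightAt, Finset.mul_sum, Nat.cast_sum]
    exact Finset.sum_congr rfl fun i hi => by rw [Nat.cast_mul, ha i hi, mul_assoc]
  have := le_weight_of_mem_integralClosureIdeal (c := q) (w := a) (fun g hg => by
    have h1 : (q : ℚ) ≤ (∑ i, a i * g i : ℕ) := by
      rw [key]; exact le_mul_of_one_le_right hq'.le (hG g hg)
    exact_mod_cast h1) hf hα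
  have h2 : ((q * n : ℕ) : ℚ) ≤ (∑ i, a i * α i : ℕ) := by exact_mod_cast this
  rw [key, Nat.cast_mul] at h2
  exact le_of_mul_le_mul_left h2 hq'

/-- The integral closure of a power of a monomial ideal is spanned by the monomials whose
exponents lie in the dilated Newton polyhedron. -/
theorem mem_integralClosureIdeal_iff {G : Finset (σ →₀ ℕ)} {n : ℕ} {f : MvPolynomial σ k} :
    f ∈ (Ideal.span
      ((fun α => monomial α (1 : k)) '' (G : Set (σ →₀ ℕ))) ^ n).integralClosureIdeal ↔
      ∀ α ∈ f.support, InDilatedNewton G n α := by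
  refine ⟨fun hf α hα => ?_, fun h => ?_⟩
  · by_contra hcon
    obtain ⟨w, hw, hG, hlt⟩ := exists_weight_of_not_inDilatedNewton hcon
    exact hlt.not_ge (le_weightAt_of_mem_integralClosureIdeal hw hG hf hα)
  · rw [f.as_sum]
    refine Ideal.sum_mem _ fun α hα => ?_
    rw [← mul_one (coeff α f), ← C_mul_monomial]
    exact Ideal.mul_mem_left _ _ (monomial_mem_integralClosureIdeal (h α hα))

end MvPolynomial

/-! ### Bounds for the inverse of the exponent matrix of a facet. -/

namespace Matrix

variable {σ : Type*} [Fintype σ] [DecidableEq σ]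

/-- The determinant is bounded by the product of the `ℓ¹`-norms of the rows. -/
theorem abs_det_le_prod_sum_abs (A : Matrix σ σ ℤ) : |A.det| ≤ ∏ l, ∑ i, |A l i| := by
  rw [← Matrix.det_transpose, Matrix.det_apply']
  refine (Finset.abs_sum_le_sum_abs _ _).trans ?_
  calc ∑ τ : Equiv.Perm σ, |((Equiv.Perm.sign τ : ℤ) : ℤ) * ∏ i, Aᵀ (τ i) i|
      = ∑ τ : Equiv.Perm σ, ∏ l, |A l (τ l)| := by
        refine Finset.sum_congr rfl fun τ _ => ?_
        rw [abs_mul, Finset.abs_prod]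
        rcases Int.units_eq_one_or (Equiv.Perm.sign τ) with h | h <;> simp [h]
    _ = ∑ f ∈ Finset.univ.image (fun τ : Equiv.Perm σ => (τ : σ → σ)), ∏ l, |A l (f l)| := by
        rw [Finset.sum_image fun _ _ _ _ h => Equiv.coe_fn_injective h]
    -- Permutations are among all functions, and the sum over all functions is the expanded product
    -- of the row sums.
    _ ≤ ∑ f : σ → σ, ∏ l, |A l (f l)| :=
        Finset.sum_le_sum_of_subset_of_nonneg (Finset.subset_univ _)
          fun f _ _ => Finset.prod_nonneg fun _ _ => abs_nonneg _
    _ = ∏ l, ∑ i, |A l i| := (Finset.prod_univ_sum (fun _ => Finset.univ)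
          (fun l i => |A l i|)).trans (by rw [Fintype.piFinset_univ]) |>.symm

/-- The entry is the determinant of `A` with row `j` replaced by a unit vector, whose ℓ¹-norm is 1.
-/
theorem abs_adjugate_le_prod (A : Matrix σ σ ℤ) (i j : σ) :
    |A.adjugate i j| ≤ ∏ l ∈ Finset.univ.erase j, ∑ i, |A l i| := by
  rw [adjugate_apply]
  refine (abs_det_le_prod_sum_abs _).trans (le_of_eq ?_)
  rw [← Finset.mul_prod_erase _ _ (Finset.mem_univ j)]
  have h1 : ∑ x, |(A.updateRow j (Pi.single i 1)) j x| = 1 := by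
    simp [Pi.single_apply, apply_ite abs]
  rw [h1, one_mul]
  refine Finset.prod_congr rfl fun l hl => ?_
  rw [updateRow_ne (Finset.ne_of_mem_erase hl)]

/-- If the rows of a nonnegative integer matrix lie on a hyperplane `w · x = 1` with `w > 0`,
the determinant is at least each row sum. -/
theorem sum_le_abs_det {A : Matrix σ σ ℤ} (hA : ∀ j i, 0 ≤ A j i) (hdet : A.det ≠ 0)
    {w : σ → ℚ} (hw : ∀ i, 0 < w i) (h : ∀ j, ∑ i, (A j i : ℚ) * w i = 1) (j : σ) :
    ∑ i, A j i ≤ |A.det| := by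
  -- By Cramer's rule this integer vector is det A · w. Its entries are nonzero as w > 0, hence of
  -- absolute value at least 1, and |det A| = ∑_i A_ji |a_i|.
  set a : σ → ℤ := fun i => ∑ l, A.adjugate i l with ha
  have haw : ∀ i, (a i : ℚ) = A.det * w i := by
    intro i
    have h1 : ∀ m, ∑ l, A.adjugate i l * A l m = if i = m then A.det else 0 := fun m => by
      have := congrFun (congrFun (adjugate_mul A) i) m
      rwa [mul_apply, smul_apply, one_apply, smul_eq_mul, mul_ite, mul_one, mul_zero] at this
    calc (a i : ℚ) = ∑ l, (A.adjugate i l : ℚ) * ∑ m, (A l m : ℚ) * w m := by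
          simp [ha, h]
      _ = ∑ m, ((∑ l, A.adjugate i l * A l m : ℤ) : ℚ) * w m := by
          simp only [Finset.mul_sum, Int.cast_sum, Int.cast_mul, Finset.sum_mul]
          rw [Finset.sum_comm]
          simp only [mul_assoc]
      _ = A.det * w i := by
          simp [h1]
  have habs : ∀ i, (1 : ℤ) ≤ |a i| := fun i => Int.one_le_abs fun h0 => by
    have := haw i
    rw [h0, Int.cast_zero] at this
    exact (mul_ne_zero (Int.cast_ne_zero.mpr hdet) (hw i).ne') this.symm
  have hdetj : |A.det| = ∑ i, A j i * |a i| := by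
    have : ((|A.det| : ℤ) : ℚ) = ((∑ i, A j i * |a i| : ℤ) : ℚ) := by
      have hcast : ((|A.det| : ℤ) : ℚ) = ∑ i, |(A.det : ℚ)| * ((A j i : ℚ) * w i) := by
        rw [← Finset.mul_sum, h j, mul_one, Int.cast_abs]
      rw [hcast, Int.cast_sum]
      refine Finset.sum_congr rfl fun i _ => ?_
      rw [Int.cast_mul, Int.cast_abs, haw, abs_mul, abs_of_pos (hw i)]
      ring
    exact_mod_cast this
  rw [hdetj]
  exact Finset.sum_le_sum fun i _ => le_mul_of_one_le_right (hA j i) (habs i)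

/-- Of the r - 1 row sums bounding the adjugate entry, one is absorbed by |det A| and the others are
at most `d`; this is why the exponent is r - 2. -/
theorem abs_adjugate_le_pow_mul_abs_det (hσ : 2 ≤ Fintype.card σ) {A : Matrix σ σ ℤ}
    (hA : ∀ j i, 0 ≤ A j i) (hdet : A.det ≠ 0) {w : σ → ℚ} (hw : ∀ i, 0 < w i)
    (h : ∀ j, ∑ i, (A j i : ℚ) * w i = 1) {d : ℕ} (hd : ∀ j, ∑ i, A j i ≤ d) (i j : σ) :
    |A.adjugate i j| ≤ (d : ℤ) ^ (Fintype.card σ - 2) * |A.det| := by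
  have : Nontrivial σ := Fintype.one_lt_card_iff_nontrivial.mp hσ
  obtain ⟨l, hl⟩ := exists_ne j
  have hl' : l ∈ Finset.univ.erase j := Finset.mem_erase.mpr ⟨hl, Finset.mem_univ _⟩
  refine (abs_adjugate_le_prod A i j).trans ?_
  simp only [abs_of_nonneg (hA _ _)]
  rw [← Finset.prod_erase_mul _ _ hl']
  refine mul_le_mul ?_ (sum_le_abs_det hA hdet hw h l)
    (Finset.sum_nonneg fun i _ => hA l i) (by positivity)
  refine (Finset.prod_le_prod (fun l _ => Finset.sum_nonneg fun i _ => hA l i)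
    (fun l _ => hd l)).trans (le_of_eq ?_)
  · rw [Finset.prod_const, Finset.card_erase_of_mem hl', Finset.card_erase_of_mem (Finset.mem_univ _),
      Finset.card_univ, Nat.sub_sub]

end Matrix

/-! ### Lattice points just below large dilations. -/

section NewtonPolyhedron

variable {σ : Type*} [Fintype σ] [DecidableEq σ]

/-- A spanning set of exponents contains a family, indexed by the variables, whose exponent
matrix is nonsingular. -/
theorem exists_det_ne_zero_of_span_eq_top {T : Set (σ →₀ ℕ)}
    (hT : Submodule.span ℚ (ratVec '' T) = ⊤) :
    ∃ v : σ → σ →₀ ℕ, (∀ j, v j ∈ T) ∧ (Matrix.of fun j i => (v j i : ℤ)).det ≠ 0 := by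
  obtain ⟨b, hb, hspan, hli⟩ := exists_linearIndependent ℚ (ratVec '' T)
  let B : Module.Basis b ℚ (σ → ℚ) := Module.Basis.mk hli (by
    rw [Subtype.range_coe, hspan, hT])
  let e : σ ≃ b := (Pi.basisFun ℚ σ).indexEquiv B
  choose v hvT hv using fun j => hb (e j).2
  refine ⟨v, hvT, fun h0 => ?_⟩
  have hli' : LinearIndependent ℚ (fun j => ratVec (v j)) := by
    simp only [hv]
    exact hli.comp e e.injective
  have hunit := Matrix.linearIndependent_rows_iff_isUnit (A := Matrix.of fun j => ratVec (v j)) |>.mp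
    hli'
  rw [Matrix.isUnit_iff_isUnit_det, isUnit_iff_ne_zero] at hunit
  apply hunit
  have : (Matrix.of fun j => ratVec (v j)) =
      (Int.castRingHom ℚ).mapMatrix (Matrix.of fun j i => (v j i : ℤ)) := by
    ext j i
    simp [ratVec]
  rw [this, ← RingHom.map_det, h0, map_zero]

theorem exists_sum_eq_of_card_mul_le [Nonempty σ] {D n : ℕ} (h : Fintype.card σ * D ≤ n) :
    ∃ m : σ → ℕ, (∀ j, D ≤ m j) ∧ ∑ j, m j = n := by
  obtain ⟨j₀⟩ := ‹Nonempty σ›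
  refine ⟨fun j => D + if j = j₀ then n - Fintype.card σ * D else 0,
    fun j => Nat.le_add_right _ _, ?_⟩
  rw [Finset.sum_add_distrib, Finset.sum_ite_eq' _ j₀]
  simp only [Finset.sum_const, Finset.card_univ, smul_eq_mul, Finset.mem_univ, if_true]
  omega

/-- If the Newton polyhedron of `G` has a compact facet, all its sufficiently large dilations have
lattice points immediately below them. -/
theorem exists_just_below_dilatedNewton (hσ : 2 ≤ Fintype.card σ) {G : Finset (σ →₀ ℕ)}
    {w : σ → ℚ} (hw : ∀ i, 0 < w i) (hG : ∀ g ∈ G, 1 ≤ weightAt w g)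
    (hspan : Submodule.span ℚ (ratVec '' {g | g ∈ G ∧ weightAt w g = 1}) = ⊤)
    {d : ℕ} (hd : ∀ g ∈ G, g.degree ≤ d) {n : ℕ}
    (hn : Fintype.card σ * (2 * d ^ (Fintype.card σ - 2)) ≤ n) :
    ∃ β : σ →₀ ℕ, ¬ InDilatedNewton G n β ∧
      ∀ i, InDilatedNewton G n (β + Finsupp.single i 1) := by
  have hne : Nonempty σ := Fintype.card_pos_iff.mp (by omega)
  obtain ⟨v, hv, hdet⟩ := exists_det_ne_zero_of_span_eq_top hspan
  set A : Matrix σ σ ℤ := Matrix.of fun j i => (v j i : ℤ) with hA_def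
  have hA : ∀ j i, A j i = v j i := fun j i => rfl
  have hdetQ : (A.det : ℚ) ≠ 0 := Int.cast_ne_zero.mpr hdet
  let M : σ → σ → ℚ := fun i j => A.adjugate i j / A.det
  -- M is the inverse of the exponent matrix, so e_i = ∑_j M_ij v_j; applying w, which is 1 on every
  -- v_j, gives ∑_j M_ij = w_i.
  have hMv : ∀ i l, ∑ j, M i j * v j l = if i = l then 1 else 0 := by
    intro i l
    have h1 := congrFun (congrFun (Matrix.adjugate_mul A) i) l
    rw [Matrix.mul_apply, Matrix.smul_apply, Matrix.one_apply, smul_eq_mul, mul_ite, mul_one,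
      mul_zero] at h1
    have h2 := congrArg (Int.cast : ℤ → ℚ) h1
    simp only [Int.cast_sum, Int.cast_mul, Int.cast_ite, Int.cast_zero, hA, Int.cast_natCast] at h2
    simp only [M, div_mul_eq_mul_div]
    rw [← Finset.sum_div, h2]
    split_ifs
    · exact div_self hdetQ
    · exact zero_div _
  have hMw : ∀ i, ∑ j, M i j = w i := by
    intro i
    calc ∑ j, M i j = ∑ j, M i j * weightAt w (v j) := by simp [(hv _).2]
      _ = ∑ l, w l * ∑ j, M i j * v j l := by
          simp only [weightAt, Finset.mul_sum]
          rw [Finset.sum_comm]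
          exact Finset.sum_congr rfl fun _ _ => Finset.sum_congr rfl fun _ _ => by ring
      _ = w i := by simp [hMv]
  have hMabs : ∀ i j, |M i j| ≤ (d : ℚ) ^ (Fintype.card σ - 2) := by
    intro i j
    have h1 := Matrix.abs_adjugate_le_pow_mul_abs_det hσ (A := A)
      (fun j i => by rw [hA]; positivity) hdet hw
      (fun j => by
        rw [← (hv j).2, weightAt]
        exact Finset.sum_congr rfl fun i _ => by rw [hA, Int.cast_natCast, mul_comm])
      (d := d) (fun j => by
        have := hd _ (hv j).1
        rw [Finsupp.degree_eq_sum] at this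
        simp only [hA]
        exact_mod_cast this) i j
    rw [abs_div, div_le_iff₀ (abs_pos.mpr hdetQ)]
    exact_mod_cast h1
  obtain ⟨m, hm, hmn⟩ := exists_sum_eq_of_card_mul_le hn
  -- Subtracting the unit vector of least weight ensures that adding back any e_i restores weight at
  -- least n.
  obtain ⟨i₀, -, hi₀⟩ := Finset.exists_min_image Finset.univ w Finset.univ_nonempty
  -- Some v_j involves i₀, so e_{i₀} can be subtracted from ∑ m_j v_j within the natural numbers.
  obtain ⟨j₁, hj₁⟩ : ∃ j, v j i₀ ≠ 0 := by
    by_contra hcon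
    push Not at hcon
    have := hMv i₀ i₀
    simp [hcon] at this
  have hd1 : 0 < d := by
    have h1 := Finsupp.le_degree i₀ (v j₁)
    have h2 := hd _ (hv j₁).1
    omega
  have hm1 : ∀ j, 1 ≤ m j := fun j => by
    have := Nat.pow_pos (n := Fintype.card σ - 2) hd1
    have := hm j
    omega
  have hγ : ∀ l, (∑ j, m j • v j : σ →₀ ℕ) l = ∑ j, m j * v j l := fun l => by
    simp [Finsupp.finsetSum_apply]
  obtain ⟨β, hβ⟩ : ∃ β, Finsupp.single i₀ 1 + β = ∑ j, m j • v j := by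
    have : Finsupp.single i₀ 1 ≤ ∑ j, m j • v j := by
      rw [Finsupp.single_le_iff, hγ]
      calc 1 ≤ m j₁ * v j₁ i₀ := Nat.mul_pos (hm1 j₁) (Nat.pos_of_ne_zero hj₁)
        _ ≤ _ := Finset.single_le_sum (f := fun j => m j * v j i₀)
          (fun _ _ => Nat.zero_le _) (Finset.mem_univ j₁)
    obtain ⟨β, hβ⟩ := exists_add_of_le this
    exact ⟨β, hβ.symm⟩
  have hwγ : weightAt w (∑ j, m j • v j) = n := by
    calc weightAt w (∑ j, m j • v j) = ∑ j, m j * weightAt w (v j) := by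
          simp only [weightAt, hγ, Nat.cast_sum, Nat.cast_mul, Finset.mul_sum]
          rw [Finset.sum_comm]
          exact Finset.sum_congr rfl fun _ _ => Finset.sum_congr rfl fun _ _ => by ring
      _ = n := by simp [(hv _).2, ← hmn]
  refine ⟨β, fun hcon => ?_, fun i => ?_⟩
  · have h1 := hcon.le_weightAt (fun i => (hw i).le) hG
    rw [← hβ, weightAt_add, weightAt_single] at hwγ
    linarith [hw i₀]
  · refine InDilatedNewton.of_family v (fun j => (hv j).1)
      (fun j => m j + M i j - M i₀ j) (fun j => ?_) ?_ fun l => ?_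
    -- The factor 2 in the bound on m_j pays for the two entries M_ij and M_{i₀j}.
    · have h1 := abs_le.mp (hMabs i j)
      have h2 := abs_le.mp (hMabs i₀ j)
      have h3 : (2 * (d : ℚ) ^ (Fintype.card σ - 2)) ≤ m j := by exact_mod_cast hm j
      linarith [h1.1, h2.2]
    · rw [Finset.sum_sub_distrib, Finset.sum_add_distrib, hMw, hMw, ← Nat.cast_sum, hmn]
      linarith [hi₀ i (Finset.mem_univ i)]
    · have h1 := congrArg (fun γ : σ →₀ ℕ => ((γ l : ℕ) : ℚ)) hβ
      simp only [hγ, Finsupp.add_apply, Nat.cast_add, Nat.cast_sum, Nat.cast_mul,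
        Finsupp.single_apply] at h1
      simp only [sub_mul, add_mul, Finset.sum_sub_distrib, Finset.sum_add_distrib, hMv, ← h1,
        Finsupp.add_apply, Finsupp.single_apply, Nat.cast_add, Nat.cast_ite, Nat.cast_one,
        Nat.cast_zero]
      linarith

end NewtonPolyhedron

/-! ### Associated primes and lattice points just below the polyhedron. -/

namespace MvPolynomial

variable {σ k : Type*} [Field k] [Fintype σ]

theorem exists_just_below_of_idealOfVars_mem_associatedPrimes {G : Finset (σ →₀ ℕ)} {n : ℕ}
    (h : idealOfVars σ k ∈ associatedPrimes (MvPolynomial σ k) (MvPolynomial σ k ⧸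
      (Ideal.span ((fun α => monomial α (1 : k)) '' (G : Set (σ →₀ ℕ))) ^
        n).integralClosureIdeal)) :
    ∃ α, ¬ InDilatedNewton G n α ∧ ∀ i, InDilatedNewton G n (α + Finsupp.single i 1) := by
  obtain ⟨hprime, x, hx⟩ := isAssociatedPrime_iff.mp h
  obtain ⟨f, rfl⟩ := Ideal.Quotient.mk_surjective x
  have hcolon : ∀ p, p ∈ idealOfVars σ k ↔ p * f ∈ (Ideal.span
      ((fun α => monomial α (1 : k)) '' (G : Set (σ →₀ ℕ))) ^ n).integralClosureIdeal := by
    intro p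
    rw [hx, Submodule.mem_colon_singleton, Submodule.mem_bot, ← Ideal.Quotient.eq_zero_iff_mem,
      map_mul]
    rfl
  have hf : f ∉ (Ideal.span
      ((fun α => monomial α (1 : k)) '' (G : Set (σ →₀ ℕ))) ^ n).integralClosureIdeal := by
    intro hf
    exact hprime.ne_top ((Ideal.eq_top_iff_one _).mpr ((hcolon 1).mpr (by rwa [one_mul])))
  rw [mem_integralClosureIdeal_iff] at hf
  push Not at hf
  -- Any exponent of `f` outside the polyhedron works: multiplication by X_i shifts the support by
  -- e_i, and X_i f lies in the closure.
  obtain ⟨α, hα, hαG⟩ := hf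
  refine ⟨α, hαG, fun i => ?_⟩
  refine mem_integralClosureIdeal_iff.mp
    ((hcolon (X i)).mp (Ideal.subset_span (Set.mem_range_self i))) _ ?_
  rw [mem_support_iff, add_comm α, coeff_X_mul]
  exact mem_support_iff.mp hα

theorem idealOfVars_mem_associatedPrimes_of_just_below {G : Finset (σ →₀ ℕ)} {n : ℕ}
    (hprime : (idealOfVars σ k).IsPrime) {β : σ →₀ ℕ} (hβ : ¬ InDilatedNewton G n β)
    (hβ' : ∀ i, InDilatedNewton G n (β + Finsupp.single i 1)) :
    idealOfVars σ k ∈ associatedPrimes (MvPolynomial σ k) (MvPolynomial σ k ⧸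
      (Ideal.span ((fun α => monomial α (1 : k)) '' (G : Set (σ →₀ ℕ))) ^
        n).integralClosureIdeal) := by
  refine isAssociatedPrime_iff.mpr ⟨hprime, Ideal.Quotient.mk _ (monomial β 1), ?_⟩
  have hcolon : ∀ p, p ∈ (⊥ : Submodule (MvPolynomial σ k) (MvPolynomial σ k ⧸
      (Ideal.span ((fun α => monomial α (1 : k)) '' (G : Set (σ →₀ ℕ))) ^
        n).integralClosureIdeal)).colon {Ideal.Quotient.mk _ (monomial β 1)} ↔
      p * monomial β 1 ∈ (Ideal.span
        ((fun α => monomial α (1 : k)) '' (G : Set (σ →₀ ℕ))) ^ n).integralClosureIdeal := by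
    intro p
    rw [Submodule.mem_colon_singleton, Submodule.mem_bot, ← Ideal.Quotient.eq_zero_iff_mem,
      map_mul]
    rfl
  apply le_antisymm
  · rw [Ideal.span_le]
    rintro _ ⟨i, rfl⟩
    rw [SetLike.mem_coe, hcolon, X, monomial_mul, one_mul, add_comm]
    exact monomial_mem_integralClosureIdeal (hβ' i)
  · intro p hp
    rw [hcolon, mem_integralClosureIdeal_iff] at hp
    -- Membership in m means a vanishing constant term, and the constant term of p is the
    -- coefficient of x^β in p x^β.
    rw [← pow_one (idealOfVars σ k), mem_pow_idealOfVars_iff']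
    intro γ hγ
    obtain rfl : γ = 0 := (Finsupp.degree_eq_zero_iff γ).mp (by omega)
    by_contra h0
    refine hβ (hp β ?_)
    rw [mem_support_iff, coeff_mul_monomial', if_pos le_rfl, tsub_self, mul_one]
    exact h0

end MvPolynomial

theorem lemma1p2 {k : Type*} [Field k] {r : ℕ} (hr : 2 < r)
    (I : Ideal (MvPolynomial (Fin r) k)) (hI : MvPolynomial.IsMonomialIdeal I)
    {s : ℕ} (hs : 1 ≤ s)
    (h : MvPolynomial.idealOfVars (Fin r) k ∈
      associatedPrimes (MvPolynomial (Fin r) k)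
        (MvPolynomial (Fin r) k ⧸ (I ^ s).integralClosureIdeal))
    (n : ℕ) (hn : (r - 1) * r * MvPolynomial.maxGenDegree I ^ (r - 2) ≤ n) :
    MvPolynomial.idealOfVars (Fin r) k ∈
      associatedPrimes (MvPolynomial (Fin r) k)
        (MvPolynomial (Fin r) k ⧸ (I ^ n).integralClosureIdeal) := by
  have hfin := MvPolynomial.finite_minimalGenerators I
  have hspan : I = Ideal.span ((fun α => MvPolynomial.monomial α (1 : k)) ''
      (hfin.toFinset : Set (Fin r →₀ ℕ))) := by
    rw [hfin.coe_toFinset, hI.span_minimalGenerators]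
  have hdeg : ∀ g ∈ hfin.toFinset, g.degree ≤ MvPolynomial.maxGenDegree I :=
    fun g hg => Finset.le_sup (f := Finsupp.degree) hg
  generalize MvPolynomial.maxGenDegree I = d at hn hdeg
  generalize hfin.toFinset = G at hspan hdeg
  subst hspan
  obtain ⟨α, hα, hα'⟩ :=
    MvPolynomial.exists_just_below_of_idealOfVars_mem_associatedPrimes h
  obtain ⟨w, hw, hG, htop⟩ := exists_positive_weight_span_eq_top hα hα'
  obtain ⟨β, hβ, hβ'⟩ := exists_just_below_dilatedNewton (n := n)
    (by rw [Fintype.card_fin]; omega) hw hG htop hdeg (by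
      rw [Fintype.card_fin]
      refine le_trans ?_ hn
      rw [← mul_assoc]
      -- The construction needs only n ≥ 2 r d^(r-2); here r > 2 enters as 2 ≤ r - 1.
      refine Nat.mul_le_mul_right _ ?_
      rw [mul_comm]
      exact Nat.mul_le_mul_right _ (by omega))
  exact MvPolynomial.idealOfVars_mem_associatedPrimes_of_just_below
    (AssociatedPrimes.mem_iff.mp h).isPrime hβ hβ'
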